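/- \textbf{Theorem (Gaussian behavior of the number of summands for $(s,b)$-Generacci decompositions).} Fix integers $s,b\ge 1$. Given an increasing sequence of positive integers $(a_i)_{i\ge 1}$, let its $j$-th bin be $\mathcal B_j=\{a_{b(j-1)+1},\dots,a_{bj}\}$ for $j\ge 1$. A \emph{legal decomposition} of an integer $m\ge 0$ is an expression of $m$ as a (possibly empty, for $m=0$) finite sum of distinct terms $a_i$ such that any two summands lie in different bins with at least $s$ bins strictly between them. The \emph{$(s,b)$-Generacci sequence} is the increasing sequence of positive integers $(a_i)_{i\ge1}$ such that, for every $i\ge 1$, $a_i$ is the smallest positive integer that has no legal decomposition using only $a_1,\dots,a_{i-1}$. Every integer $m\ge 0$ has exactly one legal decomposition into terms of the $(s,b)$-Generacci sequence. For $n\ge 0$ let $Y_n$ be the number of summands in the legal decomposition of an integer chosen uniformly at random from $[0,a_{bn+1})$, and let $\mu_n$ and $\sigma_n^2$ be the mean and variance of $Y_n$. Then there are real constants $A,B,C,D>0$, depending only on $s$ and $b$, such that, as $n\to\infty$, $$\mu_n = An+B+o(1),\qquad \sigma_n^2 = Cn+D+o(1).$$ Moreover, the normalized variable $Y_n'=(Y_n-\mu_n)/\sigma_n$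 (set equal to $0$ when $\sigma_n=0$, which happens for at most finitely many $n$) converges in distribution to the standard normal distribution as $n\to\infty$. -/

import Mathlib

open MeasureTheory ProbabilityTheory Filter Asymptotics

namespace Generacci

/-- The (1-based) number of the bin that holds the index `i ≥ 1`, where the `j`-th bin consists of
the indices `b * (j - 1) + 1, …, b * j`. -/
def binIndex (b i : ℕ) : ℕ := (i - 1) / b + 1

theorem binIndex_eq_iff {b i j : ℕ} (hb : 1 ≤ b) (hi : 1 ≤ i) (hj : 1 ≤ j) :
    binIndex b i = j ↔ i ∈ Finset.Icc (b * (j - 1) + 1) (b * j) := by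
  obtain ⟨i, rfl⟩ := Nat.exists_eq_add_of_le' hi
  obtain ⟨j, rfl⟩ := Nat.exists_eq_add_of_le' hj
  simp only [binIndex, Nat.add_sub_cancel, Finset.mem_Icc, add_left_inj]
  rw [Nat.div_eq_iff (by omega), Nat.mul_add, mul_comm b j]
  omega

/-- A finite set `S` of positive indices is legal if any two distinct elements lie in different
bins with at least `s` bins strictly between them. -/
def IsLegal (s b : ℕ) (S : Finset ℕ) : Prop :=
  (∀ i ∈ S, 1 ≤ i) ∧ ∀ i ∈ S, ∀ k ∈ S, i < k → binIndex b i + s < binIndex b k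

/-- `S` is the index set of a legal decomposition of `m` into terms of the sequence `a` (the empty
set being the decomposition of `0`). -/
def IsLegalDecomp (s b : ℕ) (a : ℕ → ℕ) (m : ℕ) (S : Finset ℕ) : Prop :=
  IsLegal s b S ∧ ∑ i ∈ S, a i = m

/-- The defining property of the `(s,b)`-Generacci sequence `a 1, a 2, …` (the value `a 0` plays no
role): it is increasing, and each `a i` is the smallest positive integer that has no legal
decomposition using only `a 1, …, a (i - 1)`. -/
structure IsGeneracci (s b : ℕ) (a : ℕ → ℕ) : Prop where
  increasing : StrictMonoOn a (Set.Ici 1)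
  isLeast : ∀ i, 1 ≤ i →
    IsLeast {m : ℕ | 0 < m ∧ ¬ ∃ S, (∀ j ∈ S, j < i) ∧ IsLegalDecomp s b a m S} (a i)

/-- The `(s,b)`-Generacci sequence, defined by recursion (`generacci s b 0` is a dummy value). -/
noncomputable def generacci (s b i : ℕ) : ℕ :=
  sInf {m : ℕ | 0 < m ∧ ¬ ∃ S : Finset ℕ, ∃ _hS : ∀ j ∈ S, j < i,
    IsLegal s b S ∧ ∑ j ∈ S.attach, generacci s b j.1 = m}
termination_by i
decreasing_by exact _hS j.1 j.2

theorem generacci_eq (s b i : ℕ) :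
    generacci s b i = sInf {m : ℕ | 0 < m ∧
      ¬ ∃ S, (∀ j ∈ S, j < i) ∧ IsLegalDecomp s b (generacci s b) m S} := by
  rw [generacci]
  congr 1
  ext m
  simp only [Set.mem_ofPred_eq, IsLegalDecomp, exists_prop]
  refine and_congr_right fun _ => not_congr (exists_congr fun S => ?_)
  rw [Finset.sum_attach S (generacci s b)]

theorem generacci_isLeast (s b i : ℕ) :
    IsLeast {m : ℕ | 0 < m ∧
      ¬ ∃ S, (∀ j ∈ S, j < i) ∧ IsLegalDecomp s b (generacci s b) m S} (generacci s b i) := by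
  rw [generacci_eq]
  refine ⟨Nat.sInf_mem ⟨∑ j ∈ Finset.range i, generacci s b j + 1, Nat.succ_pos _, ?_⟩,
    fun m hm => Nat.sInf_le hm⟩
  rintro ⟨S, hS, -, h⟩
  have : ∑ j ∈ S, generacci s b j ≤ ∑ j ∈ Finset.range i, generacci s b j :=
    Finset.sum_le_sum_of_subset fun j hj => Finset.mem_range.2 (hS j hj)
  omega

theorem generacci_pos (s b i : ℕ) : 0 < generacci s b i := (generacci_isLeast s b i).1.1

theorem isGeneracci_generacci (s b : ℕ) : IsGeneracci s b (generacci s b) where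
  isLeast i _ := generacci_isLeast s b i
  increasing := by
    intro i hi k _ hik
    refine lt_of_le_of_ne ((generacci_isLeast s b i).2 ⟨generacci_pos s b k, ?_⟩) fun h => ?_
    · rintro ⟨S, hS, h⟩
      exact (generacci_isLeast s b k).1.2 ⟨S, fun j hj => (hS j hj).trans hik, h⟩
    · refine (generacci_isLeast s b k).1.2 ⟨{i}, by simpa using hik, ⟨?_, ?_⟩, by simpa using h⟩
      · simpa using hi
      · intro j hj l hl hjl
        simp only [Finset.mem_singleton] at hj hl
        omega

theorem IsGeneracci.eq_generacci {s b : ℕ} {a : ℕ → ℕ} (ha : IsGeneracci s b a) :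
    ∀ i, 1 ≤ i → a i = generacci s b i := by
  intro i
  induction i using Nat.strong_induction_on with
  | _ i ih =>
    intro hi
    refine (ha.isLeast i hi).unique ?_
    have key : {m : ℕ | 0 < m ∧ ¬ ∃ S, (∀ j ∈ S, j < i) ∧ IsLegalDecomp s b a m S} =
        {m : ℕ | 0 < m ∧
          ¬ ∃ S, (∀ j ∈ S, j < i) ∧ IsLegalDecomp s b (generacci s b) m S} := by
      ext m
      refine and_congr_right fun _ => not_congr (exists_congr fun S => and_congr_right fun hS => ?_)
      refine and_congr_right fun hL => ?_
      rw [Finset.sum_congr rfl fun j hj => ih j (hS j hj) (hL.1 j hj)]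
    rw [key]
    exact generacci_isLeast s b i

/-- The number of summands in the legal decomposition of `m` into terms of the `(s,b)`-Generacci
sequence (which exists and is unique for every `m` when `s, b ≥ 1`, as the theorem asserts). -/
noncomputable def numSummands (s b m : ℕ) : ℕ :=
  (Classical.epsilon fun S : Finset ℕ => IsLegalDecomp s b (generacci s b) m S).card

/-- The uniform probability measure on the integers of `[0, a_{bn+1})`. -/
noncomputable def unif (s b n : ℕ) : Measure ℕ :=
  uniformOn (Set.Ico 0 (generacci s b (b * n + 1)))

instance (s b n : ℕ) : IsProbabilityMeasure (unif s b n) :=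
  isProbabilityMeasure_uniformOn (Set.finite_Ico _ _) ⟨0, le_rfl, generacci_pos _ _ _⟩

/-- The mean of the number of summands over `[0, a_{bn+1})`. -/
noncomputable def mean (s b n : ℕ) : ℝ := ∫ m, (numSummands s b m : ℝ) ∂(unif s b n)

/-- The variance of the number of summands over `[0, a_{bn+1})`. -/
noncomputable def var (s b n : ℕ) : ℝ := Var[fun m => (numSummands s b m : ℝ); unif s b n]

end Generacci

/-! The largest index `i` of a legal set leaves a free legal set below `gapIndex s b i`. By
induction the legal sets below `i` have distinct sums that fill `[0, a_i)`, which gives existence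
and uniqueness and `a_{i+1} = a_i + a_{gapIndex i}`. All `b` indices of a bin have the same gap
index, so the sum of `g(Y)` over all integers below the first term of a bin satisfies one linear
recurrence: the next bin is either empty or supplies one of `b` summands and blocks the `s` bins
before it (`binSum_recurrence`).

Let `q` in `(0,1)` solve `q + b q^(s+1) = 1` and put `p = 1 - q`. Multiplied by `q^k`, the counts
satisfy the averaging recurrence `w (k+s+1) = q w (k+s) + p w k`. Its limit needs no roots of the
characteristic polynomial: the oscillation over `s + 1` consecutive values contracts geometrically,
and `w (k+s) + p ∑_{j<s} w (k+j)` is constant in `k`, so `w` tends to that constant divided by `1 +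
s p`. This is a renewal picture: a step has length 1 and no summand with probability `q`, or length
`s + 1` and one summand with probability `p`. So `A = p/(1 + s p)` is summands per unit length, and
`C` is the second moment of (summands minus `A` times length), divided by the mean length `1 + s p`.

With these `A` and `C` the centred first and second moments satisfy the same recurrence up to a
telescoping term, hence converge (`tendsto_of_recurrence`). For the limit law, `exp(iθA - Cθ²/2)`
approximates the relative growth of the character sums with error `o(θ²)`. At `θ` of order
`n^(-1/2)` this error is negligible over `n` steps (`tendsto_of_perturbed_recurrence`), so the
characteristic functions converge to `exp(-t²/2)`. -/

namespace Generacci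

/-! ### Legal decompositions and the index recurrence -/

/-- A legal set of largest index `i` consists of `i` and a legal set of indices below
`gapIndex s b i`. -/
def gapIndex (s b i : ℕ) : ℕ := b * ((i - 1) / b - s) + 1

theorem one_le_gapIndex (s b i : ℕ) : 1 ≤ gapIndex s b i := Nat.le_add_left _ _

theorem gapIndex_le {s b i : ℕ} (hi : 1 ≤ i) : gapIndex s b i ≤ i := by
  have h1 : b * ((i - 1) / b - s) ≤ b * ((i - 1) / b) := Nat.mul_le_mul_left _ (Nat.sub_le _ _)
  have h2 := Nat.mul_div_le (i - 1) b
  unfold gapIndex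
  omega

theorem binIndex_add_lt_iff {s b i j : ℕ} (hb : 1 ≤ b) (hj : 1 ≤ j) :
    binIndex b j + s < binIndex b i ↔ j < gapIndex s b i := by
  have h1 : (j - 1) / b < (i - 1) / b - s ↔ j - 1 < ((i - 1) / b - s) * b :=
    Nat.div_lt_iff_lt_mul (by omega)
  rw [mul_comm] at h1
  unfold binIndex gapIndex
  generalize (j - 1) / b = x at *
  generalize (i - 1) / b = y at *
  generalize b * (y - s) = z at *
  omega

theorem IsLegal.mono {s b : ℕ} {S T : Finset ℕ} (hT : IsLegal s b T) (h : S ⊆ T) :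
    IsLegal s b S :=
  ⟨fun i hi => hT.1 i (h hi), fun i hi k hk => hT.2 i (h hi) k (h hk)⟩

theorem isLegal_empty (s b : ℕ) : IsLegal s b ∅ := by simp [IsLegal]

theorem IsLegal.insert {s b i : ℕ} {S : Finset ℕ} (hb : 1 ≤ b) (hi : 1 ≤ i) (hS : IsLegal s b S)
    (h : ∀ j ∈ S, j < gapIndex s b i) : IsLegal s b (insert i S) := by
  have hlt : ∀ j ∈ S, j < i := fun j hj => (h j hj).trans_le (gapIndex_le hi)
  refine ⟨fun j hj => ?_, fun j hj k hk hjk => ?_⟩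
  · rcases Finset.mem_insert.1 hj with rfl | hj
    exacts [hi, hS.1 j hj]
  · rcases Finset.mem_insert.1 hj with rfl | hj'
    · rcases Finset.mem_insert.1 hk with rfl | hk
      · omega
      · have := hlt k hk
        omega
    · rcases Finset.mem_insert.1 hk with rfl | hk'
      · exact (binIndex_add_lt_iff hb (hS.1 j hj')).2 (h j hj')
      · exact hS.2 j hj' k hk' hjk

theorem IsLegal.lt_gapIndex {s b i : ℕ} {S : Finset ℕ} (hb : 1 ≤ b) (hS : IsLegal s b S)
    (hi : i ∈ S) (h : ∀ j ∈ S, j < i + 1) : ∀ j ∈ S.erase i, j < gapIndex s b i := by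
  intro j hj
  obtain ⟨hne, hj⟩ := Finset.mem_erase.1 hj
  refine (binIndex_add_lt_iff hb (hS.1 j hj)).1 (hS.2 j hj i hi ?_)
  have := h j hj
  omega

/-- The legal sets of indices below `i` have distinct sums, which fill `[0, a i)`. -/
structure IsComplete (s b i : ℕ) : Prop where
  exists_decomp : ∀ m < generacci s b i,
    ∃ S, (∀ j ∈ S, j < i) ∧ IsLegalDecomp s b (generacci s b) m S
  sum_lt : ∀ S, (∀ j ∈ S, j < i) → IsLegal s b S → ∑ j ∈ S, generacci s b j < generacci s b i
  unique : ∀ S T, (∀ j ∈ S, j < i) → (∀ j ∈ T, j < i) → IsLegal s b S → IsLegal s b T →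
    ∑ j ∈ S, generacci s b j = ∑ j ∈ T, generacci s b j → S = T

theorem IsLegal.eq_empty {s b : ℕ} {S : Finset ℕ} (hS : IsLegal s b S) (h : ∀ j ∈ S, j < 1) :
    S = ∅ := by
  refine Finset.eq_empty_of_forall_notMem fun j hj => ?_
  have h1 := hS.1 j hj
  have h2 := h j hj
  omega

theorem generacci_one (s b : ℕ) : generacci s b 1 = 1 := by
  refine (generacci_isLeast s b 1).unique ⟨⟨one_pos, ?_⟩, fun m hm => hm.1⟩
  rintro ⟨S, hS, hl, h⟩
  rw [hl.eq_empty hS] at h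
  simp at h

theorem isComplete_one (s b : ℕ) : IsComplete s b 1 where
  exists_decomp m hm := by
    rw [generacci_one] at hm
    exact ⟨∅, by simp, isLegal_empty s b, by simp; omega⟩
  sum_lt S hS hl := by
    rw [hl.eq_empty hS]
    exact generacci_pos s b 1
  unique S T hS hT hlS hlT _ := by rw [hlS.eq_empty hS, hlT.eq_empty hT]

theorem mem_erase_or_lt {i : ℕ} {S : Finset ℕ} (h : ∀ j ∈ S, j < i + 1) :
    i ∈ S ∨ ∀ j ∈ S, j < i := by
  by_cases hi : i ∈ S
  · exact Or.inl hi
  · refine Or.inr fun j hj => ?_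
    have h1 := h j hj
    have h2 : j ≠ i := fun h => hi (h ▸ hj)
    omega

theorem exists_decomp_of_lt {s b i : ℕ} (hb : 1 ≤ b) (hi : 1 ≤ i) (h : IsComplete s b i)
    (hg : IsComplete s b (gapIndex s b i)) {m : ℕ}
    (hm : m < generacci s b i + generacci s b (gapIndex s b i)) :
    ∃ S, (∀ j ∈ S, j < i + 1) ∧ IsLegalDecomp s b (generacci s b) m S := by
  rcases lt_or_ge m (generacci s b i) with hlt | hge
  · obtain ⟨S, hS, hd⟩ := h.exists_decomp m hlt
    exact ⟨S, fun j hj => (hS j hj).trans (Nat.lt_succ_self i), hd⟩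
  · obtain ⟨S, hS, hd, hsum⟩ := hg.exists_decomp (m - generacci s b i) (by omega)
    have hlt : ∀ j ∈ S, j < i := fun j hj => (hS j hj).trans_le (gapIndex_le hi)
    have hnot : i ∉ S := fun hiS => lt_irrefl _ (hlt i hiS)
    refine ⟨insert i S, fun j hj => ?_, hd.insert hb hi hS, ?_⟩
    · rcases Finset.mem_insert.1 hj with rfl | hj
      · omega
      · exact (hlt j hj).trans (Nat.lt_succ_self i)
    · rw [Finset.sum_insert hnot, hsum]
      omega

theorem sum_lt_of_legal {s b i : ℕ} (hb : 1 ≤ b) (h : IsComplete s b i)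
    (hg : IsComplete s b (gapIndex s b i)) {S : Finset ℕ} (hS : ∀ j ∈ S, j < i + 1)
    (hl : IsLegal s b S) :
    ∑ j ∈ S, generacci s b j < generacci s b i + generacci s b (gapIndex s b i) := by
  rcases mem_erase_or_lt hS with hi | hlt
  · rw [← Finset.add_sum_erase S _ hi]
    exact Nat.add_lt_add_left
      (hg.sum_lt _ (hl.lt_gapIndex hb hi hS) (hl.mono (Finset.erase_subset i S))) _
  · exact (h.sum_lt S hlt hl).trans_le (Nat.le_add_right _ _)

/-- Legal sets below `i + 1` without `i` fill `[0, a_i)`; those with `i` fill the interval of length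
`a_{gapIndex i}` that starts at `a_i`. The first integer missed is the sum. -/
theorem generacci_succ_of_isComplete {s b i : ℕ} (hb : 1 ≤ b) (hi : 1 ≤ i)
    (h : IsComplete s b i) (hg : IsComplete s b (gapIndex s b i)) :
    generacci s b (i + 1) = generacci s b i + generacci s b (gapIndex s b i) := by
  refine (generacci_isLeast s b (i + 1)).unique
    ⟨⟨Nat.add_pos_left (generacci_pos s b i) _, ?_⟩, fun m hm => ?_⟩
  · rintro ⟨S, hS, hl, hsum⟩
    exact (sum_lt_of_legal hb h hg hS hl).ne hsum
  · by_contra! hlt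
    exact hm.2 (exists_decomp_of_lt hb hi h hg hlt)

theorem IsComplete.succ {s b i : ℕ} (hb : 1 ≤ b) (hi : 1 ≤ i) (h : IsComplete s b i)
    (hg : IsComplete s b (gapIndex s b i)) : IsComplete s b (i + 1) where
  exists_decomp m hm := by
    rw [generacci_succ_of_isComplete hb hi h hg] at hm
    exact exists_decomp_of_lt hb hi h hg hm
  sum_lt S hS hl := by
    rw [generacci_succ_of_isComplete hb hi h hg]
    exact sum_lt_of_legal hb h hg hS hl
  unique S T hS hT hlS hlT heq := by
    rcases mem_erase_or_lt hS with hiS | hltS <;> rcases mem_erase_or_lt hT with hiT | hltT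
    · rw [← Finset.add_sum_erase S _ hiS, ← Finset.add_sum_erase T _ hiT] at heq
      have := hg.unique _ _ (hlS.lt_gapIndex hb hiS hS) (hlT.lt_gapIndex hb hiT hT)
        (hlS.mono (Finset.erase_subset i S)) (hlT.mono (Finset.erase_subset i T))
        (Nat.add_left_cancel heq)
      rw [← Finset.insert_erase hiS, this, Finset.insert_erase hiT]
    -- A legal set below `i` sums to less than `a_i`, so it cannot match a set that contains `i`.
    · have := h.sum_lt T hltT hlT
      rw [← heq, ← Finset.add_sum_erase S _ hiS] at this
      omega
    · have := h.sum_lt S hltS hlS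
      rw [heq, ← Finset.add_sum_erase T _ hiT] at this
      omega
    · exact h.unique S T hltS hltT hlS hlT heq

theorem isComplete {s b i : ℕ} (hb : 1 ≤ b) (hi : 1 ≤ i) : IsComplete s b i := by
  induction i using Nat.strong_induction_on with
  | _ i ih =>
    obtain rfl | hlt := hi.eq_or_lt
    · exact isComplete_one s b
    · obtain ⟨k, rfl⟩ := Nat.exists_eq_add_of_le' hi
      have hk : 1 ≤ k := by omega
      have := gapIndex_le (s := s) (b := b) hk
      exact (ih k (by omega) hk).succ hb hk
        (ih _ (by omega) (one_le_gapIndex s b k))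

theorem generacci_succ {s b i : ℕ} (hb : 1 ≤ b) (hi : 1 ≤ i) :
    generacci s b (i + 1) = generacci s b i + generacci s b (gapIndex s b i) :=
  generacci_succ_of_isComplete hb hi (isComplete hb hi) (isComplete hb (one_le_gapIndex s b i))

theorem le_generacci {s b i : ℕ} : i ≤ generacci s b i := by
  induction i with
  | zero => exact Nat.zero_le _
  | succ i ih =>
    rcases Nat.eq_zero_or_pos i with rfl | hi
    · exact generacci_pos s b 1
    · exact ih.trans_lt ((isGeneracci_generacci s b).increasing hi
        (Set.mem_Ici.2 (by omega)) (Nat.lt_succ_self i))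

theorem isLegalDecomp_unique {s b m : ℕ} (hb : 1 ≤ b) {S T : Finset ℕ}
    (hS : IsLegalDecomp s b (generacci s b) m S) (hT : IsLegalDecomp s b (generacci s b) m T) :
    S = T := by
  have h := isComplete (s := s) hb (Nat.le_add_left 1 ((S ∪ T).sup id))
  refine h.unique S T (fun j hj => ?_) (fun j hj => ?_) hS.1 hT.1 (hS.2.trans hT.2.symm)
  · exact Nat.lt_succ_of_le (Finset.le_sup (f := id) (Finset.mem_union_left T hj))
  · exact Nat.lt_succ_of_le (Finset.le_sup (f := id) (Finset.mem_union_right S hj))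

theorem existsUnique_isLegalDecomp {s b : ℕ} (hb : 1 ≤ b) (m : ℕ) :
    ∃! S : Finset ℕ, IsLegalDecomp s b (generacci s b) m S := by
  obtain ⟨S, -, hS⟩ := (isComplete (s := s) hb (Nat.le_add_left 1 m)).exists_decomp m
    ((Nat.lt_succ_self m).trans_le le_generacci)
  exact ⟨S, hS, fun T hT => isLegalDecomp_unique hb hT hS⟩

theorem numSummands_eq_card {s b m : ℕ} (hb : 1 ≤ b) {S : Finset ℕ}
    (hS : IsLegalDecomp s b (generacci s b) m S) : numSummands s b m = S.card :=
  congrArg Finset.card (isLegalDecomp_unique hb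
    (Classical.epsilon_spec (p := IsLegalDecomp s b (generacci s b) m) ⟨S, hS⟩) hS)

theorem numSummands_zero {s b : ℕ} (hb : 1 ≤ b) : numSummands s b 0 = 0 := by
  rw [numSummands_eq_card hb ⟨isLegal_empty s b, Finset.sum_empty⟩, Finset.card_empty]

theorem numSummands_add {s b i m : ℕ} (hb : 1 ≤ b) (hi : 1 ≤ i)
    (hm : m < generacci s b (gapIndex s b i)) :
    numSummands s b (generacci s b i + m) = numSummands s b m + 1 := by
  obtain ⟨S, hS, hd⟩ := (isComplete hb (one_le_gapIndex s b i)).exists_decomp m hm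
  have hnot : i ∉ S := fun hiS => ((hS i hiS).trans_le (gapIndex_le hi)).false
  rw [numSummands_eq_card hb hd, numSummands_eq_card hb (S := insert i S)
    ⟨hd.1.insert hb hi hS, by rw [Finset.sum_insert hnot, hd.2]⟩, Finset.card_insert_of_notMem hnot]

/-! ### Recurrence over bins -/

theorem sum_range_generacci_succ {s b i : ℕ} {E : Type*} [AddCommMonoid E] (hb : 1 ≤ b)
    (hi : 1 ≤ i) (g : ℕ → E) :
    ∑ m ∈ Finset.range (generacci s b (i + 1)), g (numSummands s b m) =
      ∑ m ∈ Finset.range (generacci s b i), g (numSummands s b m) +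
        ∑ m ∈ Finset.range (generacci s b (gapIndex s b i)), g (numSummands s b m + 1) := by
  rw [generacci_succ hb hi, Finset.sum_range_add]
  congr 1
  refine Finset.sum_congr rfl fun m hm => ?_
  rw [numSummands_add hb hi (Finset.mem_range.1 hm)]

/-- The sum of `g (numSummands s b m)` over the integers `m` decomposed with the first `k - s`
bins. -/
noncomputable def binSum (s b : ℕ) {E : Type*} [AddCommMonoid E] (g : ℕ → E) (k : ℕ) : E :=
  ∑ m ∈ Finset.range (generacci s b (b * (k - s) + 1)), g (numSummands s b m)

theorem binSum_of_le {s b k : ℕ} {E : Type*} [AddCommMonoid E] (hb : 1 ≤ b) (g : ℕ → E)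
    (hk : k ≤ s) : binSum s b g k = g 0 := by
  simp [binSum, Nat.sub_eq_zero_of_le hk, generacci_one, numSummands_zero hb]

/-- The `b` indices of bin `k + 1` share one gap index, so the index recurrence adds the same sum
`b` times. The shift by `s` with truncated subtraction makes this hold from `k = 0`, with constant
initial values `g 0` for `k ≤ s`. -/
theorem binSum_recurrence {s b : ℕ} {E : Type*} [AddCommMonoid E] (hb : 1 ≤ b) (g : ℕ → E)
    (k : ℕ) : binSum s b g (k + s + 1) =
      binSum s b g (k + s) + b • binSum s b (fun y => g (y + 1)) k := by
  have key : ∀ l ≤ b,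
      ∑ m ∈ Finset.range (generacci s b (b * k + 1 + l)), g (numSummands s b m) =
      ∑ m ∈ Finset.range (generacci s b (b * k + 1)), g (numSummands s b m) +
        l • binSum s b (fun y => g (y + 1)) k := by
    intro l
    induction l with
    | zero => simp
    | succ l ih =>
      intro hl
      have hgap : gapIndex s b (b * k + 1 + l) = b * (k - s) + 1 := by
        have : (b * k + 1 + l - 1) / b = k := by
          rw [show b * k + 1 + l - 1 = l + b * k by omega, Nat.add_mul_div_left _ _ (by omega),
            Nat.div_eq_of_lt (by omega), zero_add]
        rw [gapIndex, this]
      rw [← add_assoc, sum_range_generacci_succ hb (by omega), ih (by omega), hgap, add_assoc,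
        succ_nsmul]
      rfl
  have h := key b le_rfl
  rw [show b * k + 1 + b = b * (k + 1) + 1 by ring] at h
  unfold binSum at h ⊢
  rwa [show k + s + 1 - s = k + 1 by omega, Nat.add_sub_cancel]

/-! ### Contraction and limits for averaging recurrences -/

/-- The values of `w` on the window `n, …, n + s` differ by at most `d`. -/
def OscLE {E : Type*} [NormedAddCommGroup E] (w : ℕ → E) (s n : ℕ) (d : ℝ) : Prop :=
  ∀ i ≤ s, ∀ j ≤ s, ‖w (n + i) - w (n + j)‖ ≤ d

section Oscillation

variable {E : Type*} [NormedAddCommGroup E] [NormedSpace ℝ E]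

theorem norm_sub_le_of_near_average {p q η x y : ℝ} {a c e z : E} (hp : 0 ≤ p) (hq : 0 ≤ q)
    (hpq : q + p = 1) (h : ‖z - (q • a + p • c)‖ ≤ η) (ha : ‖a - e‖ ≤ x) (hc : ‖c - e‖ ≤ y) :
    ‖z - e‖ ≤ η + (q * x + p * y) := by
  have he : z - e = (z - (q • a + p • c)) + (q • (a - e) + p • (c - e)) := by
    have : e = q • e + p • e := by rw [← add_smul, hpq, one_smul]
    nth_rewrite 1 [this]
    simp only [smul_sub]
    abel
  rw [he]
  refine (norm_add_le _ _).trans (add_le_add h ((norm_add_le _ _).trans (add_le_add ?_ ?_)))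
  · rw [norm_smul, Real.norm_of_nonneg hq]
    exact mul_le_mul_of_nonneg_left ha hq
  · rw [norm_smul, Real.norm_of_nonneg hp]
    exact mul_le_mul_of_nonneg_left hc hp

/-- New values stay near the convex hull of the old window (`hull`). After `k` steps a value still
carries weight `q ^ k` on the one `k` places earlier, so two values of the new window share at least
the fraction `q ^ (s + 1)` (`diff`). -/
theorem OscLE.block {p q η d : ℝ} {s n : ℕ} {w : ℕ → E} (hp : 0 ≤ p) (hq : 0 ≤ q)
    (hpq : q + p = 1) (hη : 0 ≤ η) (hd : OscLE w s n d)
    (h : ∀ k ≤ s, ‖w (n + k + s + 1) - (q • w (n + k + s) + p • w (n + k))‖ ≤ η) :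
    OscLE w s (n + (s + 1)) ((1 - q ^ (s + 1)) * d + (s + 1) * η) := by
  have hq1 : q ≤ 1 := by linarith
  have hd0 : 0 ≤ d := (norm_nonneg _).trans (hd 0 (Nat.zero_le _) 0 (Nat.zero_le _))
  have hull : ∀ i ≤ s + 1, ∀ j ≤ s, ‖w (n + i + s) - w (n + j)‖ ≤ d + i * η := by
    intro i
    induction i with
    | zero =>
      intro _ j hj
      simpa using hd s le_rfl j hj
    | succ i ih =>
      intro hi j hj
      have := norm_sub_le_of_near_average hp hq hpq (h i (by omega)) (ih (by omega) j hj)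
        (hd i (by omega) j hj)
      rw [show n + (i + 1) + s = n + i + s + 1 by ring]
      refine this.trans ?_
      have h2 : q * (i * η) ≤ i * η := mul_le_of_le_one_left (by positivity) hq1
      push_cast
      have h3 : q * (d + i * η) + p * d = (q + p) * d + q * (i * η) := by ring
      rw [h3, hpq]
      linarith
  have diff : ∀ i k, i + k ≤ s + 1 →
      ‖w (n + (i + k) + s) - w (n + i + s)‖ ≤ (1 - q ^ k) * (d + i * η) + k * η := by
    intro i k
    induction k with
    | zero => simp
    | succ k ih =>
      intro hk
      have h1 := hull i (by omega) (i + k) (by omega)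
      rw [norm_sub_rev] at h1
      have := norm_sub_le_of_near_average hp hq hpq (h (i + k) (by omega)) (ih (by omega)) h1
      rw [show n + (i + (k + 1)) + s = n + (i + k) + s + 1 by ring]
      refine this.trans ?_
      have h2 : q * (k * η) ≤ k * η := mul_le_of_le_one_left (by positivity) hq1
      have h3 : q * ((1 - q ^ k) * (d + i * η) + k * η) + p * (d + i * η) =
          ((q + p) - q ^ (k + 1)) * (d + i * η) + q * (k * η) := by ring
      rw [h3, hpq]
      push_cast
      linarith
  have main : ∀ i k, i + k ≤ s →
      ‖w (n + (s + 1) + (i + k)) - w (n + (s + 1) + i)‖ ≤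
        (1 - q ^ (s + 1)) * d + (s + 1) * η := by
    intro i k hik
    have h1 := diff (i + 1) k (by omega)
    rw [show n + (i + 1 + k) + s = n + (s + 1) + (i + k) by ring,
      show n + (i + 1) + s = n + (s + 1) + i by ring] at h1
    refine h1.trans ?_
    have h2 : q ^ (s + 1) ≤ q ^ k := pow_le_pow_of_le_one hq hq1 (by omega)
    have h3 : 0 ≤ q ^ k := by positivity
    have h4 : (1 - q ^ k) * d ≤ (1 - q ^ (s + 1)) * d :=
      mul_le_mul_of_nonneg_right (by linarith) hd0
    have h5 : (1 - q ^ k) * (((i + 1 : ℕ) : ℝ) * η) ≤ ((i + 1 : ℕ) : ℝ) * η :=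
      mul_le_of_le_one_left (by positivity) (by linarith)
    have h6 : ((i + 1 : ℕ) : ℝ) * η + k * η ≤ (s + 1) * η := by
      rw [← add_mul]
      refine mul_le_mul_of_nonneg_right ?_ hη
      exact_mod_cast (by omega : i + 1 + k ≤ s + 1)
    linarith
  intro i hi j hj
  rcases le_total i j with hij | hij
  · obtain ⟨k, rfl⟩ := Nat.exists_eq_add_of_le hij
    rw [norm_sub_rev]
    exact main i k hj
  · obtain ⟨k, rfl⟩ := Nat.exists_eq_add_of_le hij
    exact main j k hi

theorem oscLE_of_near_recurrence {p q η K : ℝ} {s N : ℕ} {w : ℕ → E} (hp : 0 ≤ p) (hq : 0 < q)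
    (hpq : q + p = 1) (hη : 0 ≤ η) (hK : ∀ k ≤ 2 * s, ‖w k‖ ≤ K)
    (h : ∀ k < N, ‖w (k + s + 1) - (q • w (k + s) + p • w k)‖ ≤ η) :
    OscLE w s N (2 * K * (1 - q ^ (s + 1)) ^ (N / (s + 1)) + (s + 1) * η / q ^ (s + 1)) := by
  have hqs : 0 < q ^ (s + 1) := by positivity
  -- Blocks of length `s + 1` start at the residue `t` of `N`; the first window lies in `0, …, 2 *
  -- s`, where `K` bounds `w`. The term `(s + 1) * η / q ^ (s + 1)` is the fixed point of `d ↦ (1 -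
  -- q ^ (s + 1)) * d + (s + 1) * η`.
  have key : ∀ t ≤ s, ∀ m, t + m * (s + 1) ≤ N → OscLE w s (t + m * (s + 1))
      (2 * K * (1 - q ^ (s + 1)) ^ m + (s + 1) * η / q ^ (s + 1)) := by
    intro t ht m
    induction m with
    | zero =>
      intro _ i hi j hj
      have h1 := norm_sub_le (w (t + 0 * (s + 1) + i)) (w (t + 0 * (s + 1) + j))
      have h2 := hK (t + 0 * (s + 1) + i) (by omega)
      have h3 := hK (t + 0 * (s + 1) + j) (by omega)
      have h4 : 0 ≤ (s + 1) * η / q ^ (s + 1) := by positivity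
      simp only [pow_zero, mul_one]
      linarith
    | succ m ih =>
      intro hm
      have hle : t + m * (s + 1) + (s + 1) ≤ N := by linarith
      have := (ih (by omega)).block hp hq.le hpq hη fun k hk => h _ (by omega)
      rw [show t + (m + 1) * (s + 1) = t + m * (s + 1) + (s + 1) by ring]
      convert this using 1
      field_simp
      ring
  have hmod := Nat.mod_lt N (show 0 < s + 1 by omega)
  have hdiv := Nat.mod_add_div' N (s + 1)
  have := key (N % (s + 1)) (by omega) (N / (s + 1)) hdiv.le
  rwa [hdiv] at this

theorem tendsto_pow_div_atTop_zero {x : ℝ} (hx0 : 0 ≤ x) (hx1 : x < 1) (s : ℕ) :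
    Tendsto (fun n : ℕ => x ^ (n / (s + 1))) atTop (nhds 0) :=
  (tendsto_pow_atTop_nhds_zero_of_lt_one hx0 hx1).comp (Nat.tendsto_div_const_atTop (by omega))

theorem tendsto_sub_of_near_recurrence {p q : ℝ} {s : ℕ} {w : ℕ → E} (hp : 0 ≤ p) (hq : 0 < q)
    (hpq : q + p = 1)
    (h : Tendsto (fun k => w (k + s + 1) - (q • w (k + s) + p • w k)) atTop (nhds 0))
    {j : ℕ} (hj : j ≤ s) : Tendsto (fun k => w (k + j) - w (k + s)) atTop (nhds 0) := by
  have hqs : 0 < q ^ (s + 1) := by positivity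
  rw [NormedAddGroup.tendsto_nhds_zero] at h ⊢
  intro ε hε
  -- With this `η` the fixed point of the contraction is `ε / 2`.
  set η : ℝ := ε * q ^ (s + 1) / (2 * (s + 1)) with hη
  have hη0 : 0 < η := by positivity
  obtain ⟨N, hN⟩ := eventually_atTop.1 (h η hη0)
  set K : ℝ := ∑ i ∈ Finset.range (2 * s + 1), ‖w (N + i)‖
  have hK : ∀ k ≤ 2 * s, ‖w (N + k)‖ ≤ K := fun k hk =>
    Finset.single_le_sum (f := fun i => ‖w (N + i)‖) (fun _ _ => norm_nonneg _)
      (Finset.mem_range.2 (by omega))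
  have hosc : ∀ n, OscLE (fun k => w (N + k)) s n
      (2 * K * (1 - q ^ (s + 1)) ^ (n / (s + 1)) + (s + 1) * η / q ^ (s + 1)) := fun n =>
    oscLE_of_near_recurrence hp hq hpq hη0.le hK fun k _ => by
      simpa only [add_assoc] using (hN (N + k) (by omega)).le
  have hlim : Tendsto (fun n : ℕ => 2 * K * (1 - q ^ (s + 1)) ^ (n / (s + 1))) atTop
      (nhds 0) := by
    have h1 : q ^ (s + 1) ≤ 1 := pow_le_one₀ hq.le (by linarith)
    simpa using (tendsto_pow_div_atTop_zero (by linarith) (by linarith) s).const_mul (2 * K)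
  obtain ⟨M, hM⟩ := eventually_atTop.1 (hlim.eventually_lt_const (half_pos hε))
  refine eventually_atTop.2 ⟨N + M, fun n hn => ?_⟩
  obtain ⟨k, rfl⟩ := Nat.exists_eq_add_of_le (show N ≤ n by omega)
  have h1 := hosc k j hj s le_rfl
  have h2 := hM k (by omega)
  have h3 : (s + 1) * η / q ^ (s + 1) = ε / 2 := by
    rw [hη]
    field_simp
  simp only [← add_assoc] at h1
  linarith

/-- The quantity `J` is constant because the forcing term telescopes over a window. The oscillation
tends to zero, so `J` is asymptotically `(1 + s * p) * w` minus `s` times the limit of `v`; solving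
for `w` gives the limit. -/
theorem tendsto_of_recurrence {p q : ℝ} {s : ℕ} {w v : ℕ → E} {v' : E} (hp : 0 ≤ p) (hq : 0 < q)
    (hpq : q + p = 1) (hv : Tendsto v atTop (nhds v'))
    (h : ∀ k, w (k + s + 1) = q • w (k + s) + p • w k + (v (k + s) - v k)) :
    Tendsto w atTop (nhds ((1 + s * p)⁻¹ • (w s + p • ∑ j ∈ Finset.range s, w j -
      ∑ j ∈ Finset.range s, v j + (s : ℝ) • v'))) := by
  have hQ : (1 + s * p : ℝ) ≠ 0 := by positivity
  set J : ℕ → E := fun k => w (k + s) + p • ∑ j ∈ Finset.range s, w (k + j) -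
    ∑ j ∈ Finset.range s, v (k + j) with hJ
  have hshift : ∀ (u : ℕ → E) (k : ℕ), ∑ j ∈ Finset.range s, u (k + 1 + j) =
      ∑ j ∈ Finset.range s, u (k + j) + u (k + s) - u k := by
    intro u k
    have h1 := Finset.sum_range_succ' (fun j => u (k + j)) s
    rw [Finset.sum_range_succ] at h1
    rw [h1, add_zero, add_sub_cancel_right]
    exact Finset.sum_congr rfl fun j _ => by rw [add_assoc, add_comm 1 j]
  have hconst : ∀ k, J k = J 0 := by
    intro k
    induction k with
    | zero => rfl
    | succ k ih =>
      rw [← ih]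
      simp only [hJ]
      rw [hshift w, hshift v, show k + 1 + s = k + s + 1 by ring, h k]
      rw [eq_sub_of_add_eq hpq]
      module
  have hv0 : Tendsto (fun k => v (k + s) - v k) atTop (nhds 0) := by
    simpa using (hv.comp (tendsto_add_atTop_nat s)).sub hv
  have hosc : ∀ j ≤ s, Tendsto (fun k => w (k + j) - w (k + s)) atTop (nhds 0) := fun j hj =>
    tendsto_sub_of_near_recurrence hp hq hpq (hv0.congr fun k => by rw [h k]; abel) hj
  have hw : ∀ k, w (k + s) = (1 + s * p)⁻¹ • (J 0 + ∑ j ∈ Finset.range s, v (k + j) -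
      p • ∑ j ∈ Finset.range s, (w (k + j) - w (k + s))) := by
    intro k
    rw [eq_inv_smul_iff₀ hQ, ← hconst k]
    simp only [hJ, Finset.sum_sub_distrib, Finset.sum_const, Finset.card_range, smul_sub,
      ← Nat.cast_smul_eq_nsmul ℝ, smul_smul, add_smul, one_smul, mul_comm p]
    abel
  have hlim : Tendsto (fun k => w (k + s)) atTop (nhds ((1 + s * p)⁻¹ • (J 0 +
      ∑ _j ∈ Finset.range s, v' - p • ∑ _j ∈ Finset.range s, (0 : E)))) := by
    refine Tendsto.congr (fun k => (hw k).symm) ?_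
    refine ((tendsto_const_nhds.add (tendsto_finsetSum _ fun j _ => ?_)).sub
      ((tendsto_finsetSum _ fun j hj => ?_).const_smul p)).const_smul _
    · exact hv.comp (tendsto_add_atTop_nat j)
    · exact hosc j (Finset.mem_range.1 hj).le
  rw [tendsto_add_atTop_iff_nat s (f := w)] at hlim
  simpa [hJ, Nat.cast_smul_eq_nsmul] using hlim

end Oscillation

/-- Each step now moves `J` by `(α N + β N - 1) * w N (k + s)`. Since the defect is `o(1/N)` and row
`N` is bounded by `K` up to `N + s`, the total drift over `N` steps vanishes. The deviation of `α N,
β N` from `q, p` enters the contraction only as a small error `η`. -/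
theorem tendsto_of_perturbed_recurrence {p q K : ℝ} {s : ℕ} {w : ℕ → ℕ → ℂ} {α β : ℕ → ℂ} {I : ℂ}
    (hp : 0 ≤ p) (hq : 0 < q) (hpq : q + p = 1)
    (h : ∀ N k, w N (k + s + 1) = α N * w N (k + s) + β N * w N k)
    (hα : Tendsto α atTop (nhds q)) (hβ : Tendsto β atTop (nhds p))
    (hαβ : Tendsto (fun N : ℕ => (N : ℂ) * (α N + β N - 1)) atTop (nhds 0))
    (hK : ∀ᶠ N in atTop, ∀ k ≤ N + s, ‖w N k‖ ≤ K)
    (hI : Tendsto (fun N => w N s + β N * ∑ j ∈ Finset.range s, w N j) atTop (nhds I)) :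
    Tendsto (fun N => w N (N + s)) atTop (nhds (I / (1 + s * p))) := by
  have hqs : 0 < q ^ (s + 1) := by positivity
  have hQ : (1 + s * p : ℂ) ≠ 0 := by
    have : (1 + s * p : ℝ) ≠ 0 := by positivity
    exact_mod_cast this
  have hQ' : Tendsto (fun N => 1 + s * β N) atTop (nhds (1 + s * p : ℂ)) :=
    (hβ.const_mul _).const_add _
  set J : ℕ → ℕ → ℂ := fun N k => w N (k + s) + β N * ∑ j ∈ Finset.range s, w N (k + j) with hJ
  have hstep : ∀ N k, J N (k + 1) - J N k = (α N + β N - 1) * w N (k + s) := by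
    intro N k
    have h1 := Finset.sum_range_succ' (fun j => w N (k + j)) s
    rw [Finset.sum_range_succ] at h1
    have h2 : ∑ j ∈ Finset.range s, w N (k + 1 + j) = ∑ j ∈ Finset.range s, w N (k + (j + 1)) :=
      Finset.sum_congr rfl fun j _ => by rw [add_assoc, add_comm 1 j]
    simp only [hJ]
    rw [show k + 1 + s = k + s + 1 by ring, h N k, h2]
    rw [add_zero] at h1
    linear_combination -β N * h1
  have hdrift : ∀ N, (∀ k ≤ N + s, ‖w N k‖ ≤ K) → ∀ k ≤ N,
      ‖J N k - J N 0‖ ≤ k * (‖α N + β N - 1‖ * K) := by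
    intro N hN k
    induction k with
    | zero => simp
    | succ k ih =>
      intro hk
      rw [← sub_add_sub_cancel (J N (k + 1)) (J N k) (J N 0), hstep]
      refine (norm_add_le _ _).trans ?_
      rw [norm_mul]
      have h1 := mul_le_mul_of_nonneg_left (hN (k + s) (by omega)) (norm_nonneg (α N + β N - 1))
      have h2 := ih (by omega)
      push_cast
      linarith
  have hJlim : Tendsto (fun N => J N N) atTop (nhds I) := by
    have h0 : Tendsto (fun N => J N N - J N 0) atTop (nhds 0) := by
      have hb : Tendsto (fun N : ℕ => ‖(N : ℂ) * (α N + β N - 1)‖ * K) atTop (nhds 0) := by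
        simpa using hαβ.norm.mul_const K
      refine squeeze_zero_norm' ?_ hb
      filter_upwards [hK] with N hN
      refine (hdrift N hN N le_rfl).trans_eq ?_
      rw [norm_mul, Complex.norm_natCast, mul_assoc]
    have h1 : Tendsto (fun N => J N 0) atTop (nhds I) := by simpa [hJ] using hI
    simpa using h0.add h1
  have hosc : ∀ j ≤ s, Tendsto (fun N => w N (N + j) - w N (N + s)) atTop (nhds 0) := by
    intro j hj
    have hb : Tendsto (fun N : ℕ => 2 * K * (1 - q ^ (s + 1)) ^ (N / (s + 1)) +
        (s + 1) * ((‖α N - q‖ + ‖β N - p‖) * K) / q ^ (s + 1)) atTop (nhds 0) := by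
      have h1 : q ^ (s + 1) ≤ 1 := pow_le_one₀ hq.le (by linarith)
      have h2 := (tendsto_pow_div_atTop_zero (sub_nonneg.2 h1) (by linarith) s).const_mul (2 * K)
      have h3 : Tendsto (fun N => ‖α N - q‖ + ‖β N - p‖) atTop (nhds 0) := by
        simpa using (hα.sub_const (q : ℂ)).norm.add (hβ.sub_const (p : ℂ)).norm
      simpa using h2.add (((h3.mul_const K).const_mul ((s : ℝ) + 1)).div_const (q ^ (s + 1)))
    refine squeeze_zero_norm' ?_ hb
    filter_upwards [hK, eventually_ge_atTop s] with N hN hNs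
    have hK0 : 0 ≤ K := (norm_nonneg _).trans (hN 0 (Nat.zero_le _))
    refine oscLE_of_near_recurrence (w := w N) hp hq hpq (by positivity)
      (fun k hk => hN k (by omega)) (fun k hk => ?_) j hj s le_rfl
    have he : w N (k + s + 1) - (q • w N (k + s) + p • w N k) =
        (α N - q) * w N (k + s) + (β N - p) * w N k := by
      rw [h N k, Complex.real_smul, Complex.real_smul]
      ring
    rw [he, add_mul]
    refine (norm_add_le _ _).trans ?_
    rw [norm_mul, norm_mul]
    exact add_le_add (mul_le_mul_of_nonneg_left (hN _ (by omega)) (norm_nonneg _))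
      (mul_le_mul_of_nonneg_left (hN _ (by omega)) (norm_nonneg _))
  have hlim : Tendsto (fun N => (J N N - β N * ∑ j ∈ Finset.range s,
      (w N (N + j) - w N (N + s))) / (1 + s * β N)) atTop
      (nhds ((I - p * ∑ _j ∈ Finset.range s, (0 : ℂ)) / (1 + s * p))) :=
    (hJlim.sub (hβ.mul (tendsto_finsetSum _ fun j hj =>
      hosc j (Finset.mem_range.1 hj).le))).div hQ' hQ
  simp only [Finset.sum_const_zero, mul_zero, sub_zero] at hlim
  refine hlim.congr' ?_
  filter_upwards [hQ'.eventually_ne hQ] with N hN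
  rw [div_eq_iff hN]
  simp only [hJ, Finset.sum_sub_distrib, Finset.sum_const, Finset.card_range, nsmul_eq_mul]
  ring

/-! ### Uniform averages as finite sums -/

theorem unif_eq_smul_restrict (s b n : ℕ) :
    unif s b n = (generacci s b (b * n + 1) : ENNReal)⁻¹ •
      Measure.count.restrict (Finset.range (generacci s b (b * n + 1)) : Set ℕ) := by
  rw [unif, uniformOn, ProbabilityTheory.cond, ← Finset.coe_Ico, Measure.count_apply_finset,
    Nat.card_Ico, tsub_zero, Finset.range_eq_Ico]

theorem integrableOn_count_finset {E : Type*} [NormedAddCommGroup E] (S : Finset ℕ) (f : ℕ → E) :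
    IntegrableOn f S Measure.count := by
  rw [← (S : Set ℕ).biUnion_of_singleton]
  simp [integrableOn_finset_iUnion]

theorem integral_unif {E : Type*} [NormedAddCommGroup E] [NormedSpace ℝ E] [CompleteSpace E]
    (s b n : ℕ) (f : ℕ → E) : ∫ m, f m ∂(unif s b n) =
      (generacci s b (b * n + 1) : ℝ)⁻¹ •
        ∑ m ∈ Finset.range (generacci s b (b * n + 1)), f m := by
  rw [unif_eq_smul_restrict, integral_smul_measure,
    setIntegral_finset _ (integrableOn_count_finset _ _)]
  simp [Measure.real]

theorem integrable_unif {E : Type*} [NormedAddCommGroup E] (s b n : ℕ) (f : ℕ → E) :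
    Integrable f (unif s b n) := by
  rw [unif_eq_smul_restrict]
  refine (integrableOn_count_finset _ f).smul_measure (ENNReal.inv_ne_top.2 ?_)
  exact_mod_cast (generacci_pos s b _).ne'

/-! ### Growth constants and moments -/

/-- `q` is the reciprocal of the growth rate of the number of legal sets per bin, `A` and `C` are
the growth rates of the mean and the variance of the number of summands. -/
structure IsGrowthData (s b : ℕ) (p q A C : ℝ) : Prop where
  p_pos : 0 < p
  q_pos : 0 < q
  add_eq : q + p = 1
  root : p = b * q ^ (s + 1)
  mean_eq : A * (1 + s * p) = p
  var_eq : C * (1 + s * p) = q * A ^ 2 + p * (1 - A * (s + 1)) ^ 2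

theorem exists_isGrowthData (s : ℕ) {b : ℕ} (hb : 1 ≤ b) :
    ∃ p q A C : ℝ, IsGrowthData s b p q A C := by
  have hb' : (1 : ℝ) ≤ b := by exact_mod_cast hb
  -- `x + b * x ^ (s + 1)` is `0` at `0` and `1 + b > 1` at `1`.
  obtain ⟨q, hq, hq1⟩ := intermediate_value_Ioo (zero_le_one' ℝ)
    (f := fun x => x + b * x ^ (s + 1)) (by fun_prop)
    (show (1 : ℝ) ∈ _ by simp; linarith)
  have hQ : (0 : ℝ) < 1 + s * (1 - q) := by nlinarith [hq.2, (Nat.cast_nonneg s : (0 : ℝ) ≤ s)]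
  refine ⟨1 - q, q, (1 - q) / (1 + s * (1 - q)), _, by linarith [hq.2], hq.1, by ring,
    by linarith [hq1], div_mul_cancel₀ _ hQ.ne', div_mul_cancel₀ _ hQ.ne'⟩

section Moments

variable {s b : ℕ} {p q A C : ℝ}

/-- The normalized number of legal sets. -/
noncomputable def normCount (s b : ℕ) (q : ℝ) (k : ℕ) : ℝ :=
  binSum s b (fun _ => (1 : ℝ)) k * q ^ k

/-- The normalized first moment of the number of summands about `A * k`. -/
noncomputable def normFirst (s b : ℕ) (q A : ℝ) (k : ℕ) : ℝ :=
  (binSum s b (fun y => (y : ℝ)) k - A * k * binSum s b (fun _ => (1 : ℝ)) k) * q ^ k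

/-- The normalized second moment of the number of summands about `A * k`, less its main term. -/
noncomputable def normSecond (s b : ℕ) (q A C : ℝ) (k : ℕ) : ℝ :=
  (binSum s b (fun y => (y : ℝ) ^ 2) k - 2 * A * k * binSum s b (fun y => (y : ℝ)) k +
    (A ^ 2 * k ^ 2 - C * k) * binSum s b (fun _ => (1 : ℝ)) k) * q ^ k

theorem binSum_one_pos (s b k : ℕ) : 0 < binSum s b (fun _ => (1 : ℝ)) k := by
  simpa [binSum] using generacci_pos s b _

theorem binSum_id_recurrence (hb : 1 ≤ b) (k : ℕ) :
    binSum s b (fun y => (y : ℝ)) (k + s + 1) = binSum s b (fun y => (y : ℝ)) (k + s) +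
      b * (binSum s b (fun y => (y : ℝ)) k + binSum s b (fun _ => (1 : ℝ)) k) := by
  rw [binSum_recurrence hb]
  simp only [binSum, nsmul_eq_mul, Nat.cast_add, Nat.cast_one, Finset.sum_add_distrib]

theorem binSum_sq_recurrence (hb : 1 ≤ b) (k : ℕ) :
    binSum s b (fun y => (y : ℝ) ^ 2) (k + s + 1) = binSum s b (fun y => (y : ℝ) ^ 2) (k + s) +
      b * (binSum s b (fun y => (y : ℝ) ^ 2) k + 2 * binSum s b (fun y => (y : ℝ)) k +
        binSum s b (fun _ => (1 : ℝ)) k) := by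
  rw [binSum_recurrence hb]
  simp only [binSum, nsmul_eq_mul, Nat.cast_add, Nat.cast_one, Finset.mul_sum,
    ← Finset.sum_add_distrib]
  congr 1
  exact Finset.sum_congr rfl fun m _ => by ring

theorem normCount_recurrence (hb : 1 ≤ b) (h : IsGrowthData s b p q A C) (k : ℕ) :
    normCount s b q (k + s + 1) = q * normCount s b q (k + s) + p * normCount s b q k := by
  simp only [normCount, binSum_recurrence hb, h.root, nsmul_eq_mul]
  ring

/-- The value of `A` is the one with `p * (1 - A * (s + 1)) = A * q`, which turns the forcing into a
difference of one sequence at `k + s` and `k`, as `tendsto_of_recurrence` requires. -/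
theorem normFirst_recurrence (hb : 1 ≤ b) (h : IsGrowthData s b p q A C) (k : ℕ) :
    normFirst s b q A (k + s + 1) = q * normFirst s b q A (k + s) + p * normFirst s b q A k +
      (-A * q * normCount s b q (k + s) - -A * q * normCount s b q k) := by
  have h1 : p * (1 - A * (s + 1)) = A * q := by
    linear_combination (-A) * h.add_eq - h.mean_eq
  have h2 : normFirst s b q A (k + s + 1) = q * normFirst s b q A (k + s) +
      b * q ^ (s + 1) * normFirst s b q A k + (-A * q * normCount s b q (k + s) +
      b * q ^ (s + 1) * (1 - A * (s + 1)) * normCount s b q k) := by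
    simp only [normCount, normFirst, binSum_recurrence hb (fun _ => (1 : ℝ)),
      binSum_id_recurrence hb, nsmul_eq_mul]
    push_cast
    ring
  rw [h2, ← h.root, h1]
  ring

/-- Here `C` plays the role that `A` plays for the first moment: it balances the coefficients of
`normCount`, so that the forcing telescopes again. -/
theorem normSecond_recurrence (hb : 1 ≤ b) (h : IsGrowthData s b p q A C) (k : ℕ) :
    normSecond s b q A C (k + s + 1) =
      q * normSecond s b q A C (k + s) + p * normSecond s b q A C k +
      ((2 * (-A * q) * normFirst s b q A (k + s) +
          q * (A ^ 2 - C) * normCount s b q (k + s)) -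
        (2 * (-A * q) * normFirst s b q A k + q * (A ^ 2 - C) * normCount s b q k)) := by
  have h1 : p * (1 - A * (s + 1)) = A * q := by
    linear_combination (-A) * h.add_eq - h.mean_eq
  have h2 : p * ((1 - A * (s + 1)) ^ 2 - C * (s + 1)) = -(q * (A ^ 2 - C)) := by
    linear_combination (-C) * h.add_eq - h.var_eq
  have h3 : normSecond s b q A C (k + s + 1) = q * normSecond s b q A C (k + s) +
      b * q ^ (s + 1) * normSecond s b q A C k +
      (2 * (-A * q) * normFirst s b q A (k + s) + q * (A ^ 2 - C) * normCount s b q (k + s) +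
        2 * (b * q ^ (s + 1) * (1 - A * (s + 1))) * normFirst s b q A k +
        b * q ^ (s + 1) * ((1 - A * (s + 1)) ^ 2 - C * (s + 1)) * normCount s b q k) := by
    simp only [normCount, normFirst, normSecond, binSum_recurrence hb (fun _ => (1 : ℝ)),
      binSum_id_recurrence hb, binSum_sq_recurrence hb, nsmul_eq_mul]
    push_cast
    ring
  rw [h3, ← h.root, h1, h2]
  ring

theorem normCount_of_le (hb : 1 ≤ b) {k : ℕ} (hk : k ≤ s) : normCount s b q k = q ^ k := by
  simp [normCount, binSum_of_le hb _ hk]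

theorem normFirst_of_le (hb : 1 ≤ b) {k : ℕ} (hk : k ≤ s) :
    normFirst s b q A k = -A * k * q ^ k := by
  simp [normFirst, binSum_of_le hb _ hk]

theorem normSecond_of_le (hb : 1 ≤ b) {k : ℕ} (hk : k ≤ s) :
    normSecond s b q A C k = (A ^ 2 * k ^ 2 - C * k) * q ^ k := by
  simp [normSecond, binSum_of_le hb _ hk]

theorem tendsto_normCount (hb : 1 ≤ b) (h : IsGrowthData s b p q A C) :
    Tendsto (normCount s b q) atTop (nhds (1 + s * p)⁻¹) := by
  have hlim := tendsto_of_recurrence (s := s) (w := normCount s b q) (v := fun _ => 0) h.p_pos.le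
    h.q_pos h.add_eq tendsto_const_nhds fun k => by simp [normCount_recurrence hb h]
  -- The initial values are `q ^ k` for `k ≤ s`, so the invariant equals `1`.
  have hsum : ∀ l : ℕ, q ^ l + p * ∑ j ∈ Finset.range l, q ^ j = 1 := by
    intro l
    induction l with
    | zero => simp
    | succ l ih =>
      rw [Finset.sum_range_succ]
      linear_combination ih + q ^ l * h.add_eq
  rw [normCount_of_le hb le_rfl, Finset.sum_congr rfl fun j hj =>
    normCount_of_le hb (Finset.mem_range.1 hj).le] at hlim
  simpa [hsum] using hlim

theorem tendsto_normFirst (hb : 1 ≤ b) (h : IsGrowthData s b p q A C) :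
    Tendsto (normFirst s b q A) atTop (nhds ((1 + s * p)⁻¹ * (s * (-A * q * (1 + s * p)⁻¹)))) := by
  have hlim := tendsto_of_recurrence (s := s) (w := normFirst s b q A) h.p_pos.le
    h.q_pos h.add_eq ((tendsto_normCount hb h).const_mul (-A * q))
    fun k => by simp [normFirst_recurrence hb h]
  -- The invariant vanishes on the initial data, so the limit comes only from the limit of the
  -- forcing sequence. The second moment behaves in the same way.
  have hsum : ∀ l : ℕ, -A * l * q ^ l + p * ∑ j ∈ Finset.range l, -A * j * q ^ j -
      ∑ j ∈ Finset.range l, -A * q * q ^ j = 0 := by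
    intro l
    induction l with
    | zero => simp
    | succ l ih =>
      rw [Finset.sum_range_succ, Finset.sum_range_succ]
      push_cast
      linear_combination ih - A * l * q ^ l * h.add_eq
  have hv : ∑ j ∈ Finset.range s, -A * q * normCount s b q j =
      ∑ j ∈ Finset.range s, -A * q * q ^ j :=
    Finset.sum_congr rfl fun j hj => by rw [normCount_of_le hb (Finset.mem_range.1 hj).le]
  rw [hv, normFirst_of_le hb le_rfl, Finset.sum_congr rfl fun j hj =>
    normFirst_of_le hb (Finset.mem_range.1 hj).le] at hlim
  simpa only [smul_eq_mul, hsum, zero_add] using hlim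

theorem tendsto_normSecond (hb : 1 ≤ b) (h : IsGrowthData s b p q A C) :
    Tendsto (normSecond s b q A C) atTop (nhds ((1 + s * p)⁻¹ * (s *
      (2 * (-A * q) * ((1 + s * p)⁻¹ * (s * (-A * q * (1 + s * p)⁻¹))) +
        q * (A ^ 2 - C) * (1 + s * p)⁻¹)))) := by
  have hlim := tendsto_of_recurrence (s := s) (w := normSecond s b q A C) h.p_pos.le
    h.q_pos h.add_eq (((tendsto_normFirst hb h).const_mul (2 * (-A * q))).add
      ((tendsto_normCount hb h).const_mul (q * (A ^ 2 - C))))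
    fun k => by simp only [smul_eq_mul, normSecond_recurrence hb h]
  have hsum : ∀ l : ℕ, (A ^ 2 * l ^ 2 - C * l) * q ^ l +
      p * ∑ j ∈ Finset.range l, (A ^ 2 * j ^ 2 - C * j) * q ^ j -
      ∑ j ∈ Finset.range l, (2 * (-A * q) * (-A * j * q ^ j) + q * (A ^ 2 - C) * q ^ j) = 0 := by
    intro l
    induction l with
    | zero => simp
    | succ l ih =>
      rw [Finset.sum_range_succ, Finset.sum_range_succ]
      push_cast
      linear_combination ih + (A ^ 2 * l ^ 2 - C * l) * q ^ l * h.add_eq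
  have hv : ∑ j ∈ Finset.range s,
        (2 * (-A * q) * normFirst s b q A j + q * (A ^ 2 - C) * normCount s b q j) =
      ∑ j ∈ Finset.range s, (2 * (-A * q) * (-A * j * q ^ j) + q * (A ^ 2 - C) * q ^ j) :=
    Finset.sum_congr rfl fun j hj => by
      rw [normFirst_of_le hb (Finset.mem_range.1 hj).le,
        normCount_of_le hb (Finset.mem_range.1 hj).le]
  rw [hv, normSecond_of_le hb le_rfl, Finset.sum_congr rfl fun j hj =>
    normSecond_of_le hb (Finset.mem_range.1 hj).le] at hlim
  simpa only [smul_eq_mul, hsum, zero_add] using hlim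

theorem integral_comp_numSummands {E : Type*} [NormedAddCommGroup E] [NormedSpace ℝ E]
    [CompleteSpace E] (g : ℕ → E) (n : ℕ) : ∫ m, g (numSummands s b m) ∂(unif s b n) =
      (binSum s b (fun _ => (1 : ℝ)) (n + s))⁻¹ • binSum s b g (n + s) := by
  rw [integral_unif s b n fun m => g (numSummands s b m)]
  simp [binSum]

/-- An algebraic identity for every `A`; the integers of `[0, a_{bn+1})` correspond to the shifted
index `n + s`. -/
theorem mean_eq (hq : q ≠ 0) (n : ℕ) :
    mean s b n = A * (n + s) + normFirst s b q A (n + s) / normCount s b q (n + s) := by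
  have h1 := (binSum_one_pos s b (n + s)).ne'
  rw [mean, integral_comp_numSummands (fun y => (y : ℝ)), normFirst, normCount,
    mul_div_mul_right _ _ (pow_ne_zero _ hq), smul_eq_mul]
  push_cast
  field_simp
  ring

theorem var_eq (hq : q ≠ 0) (n : ℕ) :
    var s b n = C * (n + s) + (normSecond s b q A C (n + s) / normCount s b q (n + s) -
      (normFirst s b q A (n + s) / normCount s b q (n + s)) ^ 2) := by
  have h1 := (binSum_one_pos s b (n + s)).ne'
  have h2 : var s b n = ∫ m, (numSummands s b m : ℝ) ^ 2 ∂(unif s b n) - mean s b n ^ 2 :=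
    variance_eq_sub ((memLp_two_iff_integrable_sq
      (Measurable.of_discrete.aestronglyMeasurable)).2 (integrable_unif _ _ _ _))
  rw [h2, mean_eq (A := A) hq, integral_comp_numSummands (fun y => (y : ℝ) ^ 2), smul_eq_mul,
    normFirst, normSecond, normCount, mul_div_mul_right _ _ (pow_ne_zero _ hq),
    mul_div_mul_right _ _ (pow_ne_zero _ hq)]
  push_cast
  field_simp
  ring

theorem tendsto_mean_sub (hb : 1 ≤ b) (h : IsGrowthData s b p q A C) :
    Tendsto (fun n : ℕ => mean s b n - A * (n + s)) atTop
      (nhds (-(s * A * q / (1 + s * p)))) := by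
  have hp := h.p_pos
  have hQ : (1 + s * p : ℝ) ≠ 0 := by positivity
  have hlim := ((tendsto_normFirst hb h).div (tendsto_normCount hb h) (inv_ne_zero hQ)).comp
    (tendsto_add_atTop_nat s)
  convert! hlim using 2 with n
  · simp [mean_eq (A := A) h.q_pos.ne']
  · field_simp

theorem tendsto_var_sub (hb : 1 ≤ b) (h : IsGrowthData s b p q A C) :
    Tendsto (fun n : ℕ => var s b n - C * (n + s)) atTop
      (nhds ((s * A * q / (1 + s * p)) ^ 2 + s * q * (A ^ 2 - C) / (1 + s * p))) := by
  have hp := h.p_pos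
  have hQ : (1 + s * p : ℝ) ≠ 0 := by positivity
  have hlim := (((tendsto_normSecond hb h).div (tendsto_normCount hb h) (inv_ne_zero hQ)).sub
    (((tendsto_normFirst hb h).div (tendsto_normCount hb h) (inv_ne_zero hQ)).pow 2)).comp
    (tendsto_add_atTop_nat s)
  convert! hlim using 2 with n
  · simp [var_eq (A := A) (C := C) h.q_pos.ne']
  · field_simp
    ring

theorem IsGrowthData.mean_pos (h : IsGrowthData s b p q A C) : 0 < A := by
  have hp := h.p_pos
  have hQ : (0 : ℝ) < 1 + s * p := by positivity
  exact pos_of_mul_pos_left (hp.trans_eq h.mean_eq.symm) hQ.le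

theorem IsGrowthData.var_pos (h : IsGrowthData s b p q A C) : 0 < C := by
  have hp := h.p_pos
  have hq := h.q_pos
  have hA := h.mean_pos
  have hQ : (0 : ℝ) < 1 + s * p := by positivity
  refine pos_of_mul_pos_left (lt_of_lt_of_eq ?_ h.var_eq.symm) hQ.le
  positivity

theorem exists_mean_var_asymptotics (hs : 1 ≤ s) (hb : 1 ≤ b) (h : IsGrowthData s b p q A C) :
    ∃ A B C D : ℝ, 0 < A ∧ 0 < B ∧ 0 < C ∧ 0 < D ∧
      (fun n : ℕ => mean s b n - (A * n + B)) =o[atTop] (fun _ => (1 : ℝ)) ∧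
      (fun n : ℕ => var s b n - (C * n + D)) =o[atTop] (fun _ => (1 : ℝ)) := by
  have hp := h.p_pos
  have hq := h.q_pos
  have hA := h.mean_pos
  have hC := h.var_pos
  have hs' : (0 : ℝ) < s := by exact_mod_cast hs
  have hQ : (0 : ℝ) < 1 + s * p := by positivity
  have hratio : q / (1 + s * p) < 1 := by
    rw [div_lt_one hQ]
    nlinarith [h.add_eq]
  refine ⟨A, s * A - s * A * q / (1 + s * p), C, s * C +
    ((s * A * q / (1 + s * p)) ^ 2 + s * q * (A ^ 2 - C) / (1 + s * p)), hA, ?_, hC, ?_, ?_, ?_⟩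
  · rw [mul_div_assoc, ← mul_one_sub]
    have := sub_pos.2 hratio
    positivity
  -- The only negative term, `-s * q * C / (1 + s * p)`, is absorbed by `s * C` because `q < 1 + s *
  -- p`.
  · have h1 : s * C + ((s * A * q / (1 + s * p)) ^ 2 + s * q * (A ^ 2 - C) / (1 + s * p)) =
        s * C * (1 - q / (1 + s * p)) + (s * A * q / (1 + s * p)) ^ 2 +
          s * q * A ^ 2 / (1 + s * p) := by ring
    have := sub_pos.2 hratio
    rw [h1]
    positivity
  · rw [isLittleO_one_iff]
    have := (tendsto_mean_sub hb h).sub_const (-(s * A * q / (1 + s * p)))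
    rw [sub_self] at this
    exact this.congr fun n => by ring
  · rw [isLittleO_one_iff]
    have := (tendsto_var_sub hb h).sub_const
      ((s * A * q / (1 + s * p)) ^ 2 + s * q * (A ^ 2 - C) / (1 + s * p))
    rw [sub_self] at this
    exact this.congr fun n => by ring

end Moments

/-! ### Quadratic approximation of the growth rate -/

/-- The exponent of the quadratic approximation to the growth rate at the character
`y ↦ exp (i θ y)`. -/
noncomputable def charExponent (A C θ : ℝ) : ℂ := A * θ * Complex.I - C * θ ^ 2 / 2

theorem continuous_charExponent (A C : ℝ) : Continuous (charExponent A C) := by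
  unfold charExponent
  fun_prop

theorem charExponent_zero (A C : ℝ) : charExponent A C 0 = 0 := by simp [charExponent]

theorem norm_exp_neg_charExponent (A C θ : ℝ) :
    ‖Complex.exp (-charExponent A C θ)‖ = Real.exp (C * θ ^ 2 / 2) := by
  rw [Complex.norm_exp]
  congr 1
  have : charExponent A C θ = ((-(C * θ ^ 2 / 2) : ℝ) : ℂ) + ((A * θ : ℝ) : ℂ) * Complex.I := by
    simp only [charExponent]
    push_cast
    ring
  rw [Complex.neg_re, this, Complex.add_re, Complex.re_ofReal_mul, Complex.I_re,
    Complex.ofReal_re]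
  ring

theorem exp_sub_quadratic_isLittleO (c d : ℂ) :
    (fun θ : ℝ => Complex.exp (c * θ + d * θ ^ 2) - (1 + c * θ + (d + c ^ 2 / 2) * θ ^ 2))
      =o[nhds 0] fun θ : ℝ => θ ^ 2 := by
  have h1 : Tendsto (fun θ : ℝ => c * θ + d * θ ^ 2) (nhds 0) (nhds 0) := by
    have : Continuous fun θ : ℝ => c * θ + d * θ ^ 2 := by fun_prop
    simpa using this.tendsto 0
  have hid : (fun θ : ℝ => (θ : ℂ)) =O[nhds 0] fun θ : ℝ => θ :=
    IsBigO.of_bound 1 (by simp)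
  have hlin : (fun θ : ℝ => c * θ + d * θ ^ 2) =O[nhds 0] fun θ : ℝ => θ := by
    have h2 : (fun θ : ℝ => c + d * (θ : ℂ)) =O[nhds 0] fun _ : ℝ => (1 : ℝ) := by
      have : Continuous fun θ : ℝ => c + d * (θ : ℂ) := by fun_prop
      exact (this.tendsto 0).isBigO_one ℝ
    have h3 := h2.mul hid
    simp only [one_mul] at h3
    exact h3.congr_left fun θ => by ring
  have hexp := ((Complex.exp_sub_sum_range_succ_isLittleO_pow 2).comp_tendsto h1).trans_isBigO
    (hlin.pow 2)
  -- These are the cubic and quartic terms of `(c * θ + d * θ ^ 2) ^ 2 / 2`.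
  have hcube : (fun θ : ℝ => (c * d + d ^ 2 * θ / 2) * (θ : ℂ) ^ 3) =o[nhds 0]
      fun θ : ℝ => θ ^ 2 := by
    have h2 : (fun θ : ℝ => c * d + d ^ 2 * θ / 2) =O[nhds 0] fun _ : ℝ => (1 : ℝ) := by
      have : Continuous fun θ : ℝ => c * d + d ^ 2 * θ / 2 := by fun_prop
      exact (this.tendsto 0).isBigO_one ℝ
    have h3 : (fun θ : ℝ => θ ^ 3) =o[nhds 0] fun θ : ℝ => θ ^ 2 :=
      isLittleO_pow_pow (by norm_num)
    simpa only [one_mul] using h2.mul_isLittleO ((hid.pow 3).trans_isLittleO h3)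
  refine (hexp.add hcube).congr_left fun θ => ?_
  simp only [Function.comp, Finset.sum_range_succ, Finset.sum_range_zero, Nat.factorial]
  push_cast
  ring

/-! ### Characteristic functions and the limit law -/

section CharFun

variable {s b : ℕ} {p q A C : ℝ}

/-- In the Taylor expansion the constant term cancels by `q + p = 1`, the linear term by the
equation for `A` and the quadratic term by the one for `C`. So the exact perturbed root is never
needed. -/
theorem IsGrowthData.characteristic_isLittleO (h : IsGrowthData s b p q A C) :
    (fun θ : ℝ => q * Complex.exp (-charExponent A C θ) +
      p * Complex.exp (θ * Complex.I - (s + 1) * charExponent A C θ) - 1)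
      =o[nhds 0] fun θ : ℝ => θ ^ 2 := by
  have h1 := exp_sub_quadratic_isLittleO (-(A * Complex.I)) (C / 2)
  have h2 := exp_sub_quadratic_isLittleO ((1 - A * (s + 1)) * Complex.I) ((s + 1) * C / 2)
  have hadd : (q + p : ℂ) = 1 := by exact_mod_cast h.add_eq
  have hmean : (A * (1 + s * p) : ℂ) = p := by exact_mod_cast h.mean_eq
  have hvar : (C * (1 + s * p) : ℂ) = q * A ^ 2 + p * (1 - A * (s + 1)) ^ 2 := by
    exact_mod_cast h.var_eq
  refine ((h1.const_mul_left (q : ℂ)).add (h2.const_mul_left (p : ℂ))).congr_left fun θ => ?_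
  have e1 : -(A * Complex.I) * θ + C / 2 * θ ^ 2 = -charExponent A C θ := by
    simp only [charExponent]
    ring
  have e2 : (1 - A * (s + 1)) * Complex.I * θ + (s + 1) * C / 2 * θ ^ 2 =
      θ * Complex.I - (s + 1) * charExponent A C θ := by
    simp only [charExponent]
    ring
  rw [e1, e2]
  have hI := Complex.I_sq
  linear_combination (-1 + A * Complex.I * θ - C * θ ^ 2 / 2) * hadd + Complex.I * θ * hmean -
    (θ ^ 2 / 2) * hvar - (q * A ^ 2 + p * (1 - A * (s + 1)) ^ 2) * θ ^ 2 / 2 * hI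

/-- The sum of the characters `exp (i θ y)` over the numbers of summands. -/
noncomputable def charSum (s b : ℕ) (θ : ℝ) (k : ℕ) : ℂ :=
  binSum s b (fun y => Complex.exp (θ * y * Complex.I)) k

theorem charSum_recurrence (hb : 1 ≤ b) (θ : ℝ) (k : ℕ) :
    charSum s b θ (k + s + 1) =
      charSum s b θ (k + s) + b * (Complex.exp (θ * Complex.I) * charSum s b θ k) := by
  rw [charSum, binSum_recurrence hb]
  simp only [charSum, binSum, nsmul_eq_mul, Finset.mul_sum, ← Complex.exp_add]
  congr 1
  refine Finset.sum_congr rfl fun m _ => ?_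
  push_cast
  ring_nf

theorem norm_charSum_le (θ : ℝ) (k : ℕ) :
    ‖charSum s b θ k‖ ≤ binSum s b (fun _ => (1 : ℝ)) k := by
  rw [charSum, binSum]
  refine (norm_sum_le _ _).trans_eq (Finset.sum_congr rfl fun m _ => ?_)
  rw [← Complex.ofReal_natCast, ← Complex.ofReal_mul, Complex.norm_exp_ofReal_mul_I]

/-- The limit is that of `normCount`: the initial values tend to `q ^ k`, so the invariant again
tends to `1`. -/
theorem tendsto_charSum (hb : 1 ≤ b) (h : IsGrowthData s b p q A C) {θ : ℕ → ℝ} {τ : ℝ}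
    (hθ : Tendsto θ atTop (nhds 0))
    (hτ : Tendsto (fun N : ℕ => N * θ N ^ 2) atTop (nhds τ)) :
    Tendsto (fun N : ℕ => charSum s b (θ N) (N + s) *
      (q * Complex.exp (-charExponent A C (θ N))) ^ (N + s)) atTop
      (nhds (1 / (1 + s * p))) := by
  have hexp0 : Tendsto (fun N => charExponent A C (θ N)) atTop (nhds 0) := by
    have := ((continuous_charExponent A C).tendsto 0).comp hθ
    rwa [charExponent_zero] at this
  have hα : Tendsto (fun N => q * Complex.exp (-charExponent A C (θ N))) atTop (nhds (q : ℂ)) := by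
    simpa using ((Complex.continuous_exp.tendsto _).comp hexp0.neg).const_mul (q : ℂ)
  have hθI : Tendsto (fun N => θ N * Complex.I) atTop (nhds 0) := by
    simpa using ((Complex.continuous_ofReal.tendsto 0).comp hθ).mul_const Complex.I
  have hβ : Tendsto (fun N => p * Complex.exp (θ N * Complex.I - (s + 1) *
      charExponent A C (θ N))) atTop (nhds (p : ℂ)) := by
    simpa using ((Complex.continuous_exp.tendsto _).comp
      (hθI.sub (hexp0.const_mul ((s : ℂ) + 1)))).const_mul (p : ℂ)
  obtain ⟨K, hK⟩ := (tendsto_normCount hb h).bddAbove_range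
  have hbound : ∀ᶠ N : ℕ in atTop, C * ((N + s : ℕ) * θ N ^ 2) / 2 ≤ C * (τ + 1) / 2 := by
    have hlim : Tendsto (fun N : ℕ => ((N + s : ℕ) : ℝ) * θ N ^ 2) atTop (nhds τ) := by
      have := hτ.add ((hθ.pow 2).const_mul (s : ℝ))
      simp only [ne_eq, OfNat.ofNat_ne_zero, not_false_eq_true, zero_pow, mul_zero,
        add_zero] at this
      refine this.congr fun N => ?_
      push_cast
      ring
    filter_upwards [hlim.eventually_le_const (lt_add_one τ)] with N hN
    have := h.var_pos
    gcongr
  have hpow : ∀ l : ℕ, (q : ℂ) ^ l + p * ∑ j ∈ Finset.range l, (q : ℂ) ^ j = 1 := by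
    have hadd : (q + p : ℂ) = 1 := by exact_mod_cast h.add_eq
    intro l
    induction l with
    | zero => simp
    | succ l ih =>
      rw [Finset.sum_range_succ]
      linear_combination ih + (q : ℂ) ^ l * hadd
  refine tendsto_of_perturbed_recurrence (K := K * Real.exp (C * (τ + 1) / 2))
    (w := fun N k => charSum s b (θ N) k * (q * Complex.exp (-charExponent A C (θ N))) ^ k)
    h.p_pos.le h.q_pos h.add_eq (fun N k => ?_) hα hβ ?_ ?_ ?_
  · have hroot : (p : ℂ) = b * (q : ℂ) ^ (s + 1) := by exact_mod_cast h.root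
    have hsub : Complex.exp (θ N * Complex.I - (s + 1) * charExponent A C (θ N)) =
        Complex.exp (θ N * Complex.I) * Complex.exp (-charExponent A C (θ N)) ^ (s + 1) := by
      rw [← Complex.exp_nat_mul, ← Complex.exp_add]
      push_cast
      ring_nf
    simp only [charSum_recurrence hb, hsub, hroot]
    ring
  · have hN : (fun N : ℕ => (N : ℂ)) =O[atTop] fun N : ℕ => (N : ℝ) :=
      IsBigO.of_bound 1 (by simp)
    exact (isLittleO_one_iff ℝ).1 ((hN.mul_isLittleO
      (h.characteristic_isLittleO.comp_tendsto hθ)).trans_isBigO (hτ.isBigO_one ℝ))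
  -- The character sum is at most the count in norm, and the normalization grows at most like `exp
  -- (k * C * θ ^ 2 / 2)`, bounded for `k ≤ N + s` because `N * θ ^ 2` converges.
  · filter_upwards [hbound] with N hN k hk
    rw [norm_mul, norm_pow, norm_mul, norm_exp_neg_charExponent, Complex.norm_real,
      Real.norm_of_nonneg h.q_pos.le, mul_pow, ← mul_assoc, ← Real.exp_nat_mul]
    have hq := h.q_pos
    have hC := h.var_pos
    have h1 : ‖charSum s b (θ N) k‖ * q ^ k ≤ K :=
      (mul_le_mul_of_nonneg_right (norm_charSum_le _ _) (by positivity)).trans (hK ⟨k, rfl⟩)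
    refine mul_le_mul h1 (Real.exp_le_exp.2 ?_) (by positivity)
      ((by positivity : (0 : ℝ) ≤ _).trans h1)
    refine le_trans ?_ hN
    have h2 : (k : ℝ) ≤ (N + s : ℕ) := by exact_mod_cast hk
    calc (k : ℝ) * (C * θ N ^ 2 / 2) ≤ (N + s : ℕ) * (C * θ N ^ 2 / 2) := by gcongr
      _ = _ := by ring
  · have hinit : ∀ j ≤ s, Tendsto (fun N => charSum s b (θ N) j *
        (q * Complex.exp (-charExponent A C (θ N))) ^ j) atTop (nhds ((q : ℂ) ^ j)) := by
      intro j hj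
      simpa [charSum, binSum_of_le hb _ hj] using hα.pow j
    have := (hinit s le_rfl).add (hβ.mul (tendsto_finsetSum (Finset.range s) fun j hj =>
      hinit j (Finset.mem_range.1 hj).le))
    rwa [hpow] at this

theorem tendsto_var_div (hb : 1 ≤ b) (h : IsGrowthData s b p q A C) :
    Tendsto (fun n : ℕ => var s b n / n) atTop (nhds C) := by
  have h1 := (tendsto_var_sub hb h).div_atTop tendsto_natCast_atTop_atTop
  have h2 : Tendsto (fun n : ℕ => C * s / n) atTop (nhds 0) :=
    tendsto_const_nhds.div_atTop tendsto_natCast_atTop_atTop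
  have h3 := (h1.add h2).add_const C
  rw [add_zero, zero_add] at h3
  refine h3.congr' ?_
  filter_upwards [eventually_gt_atTop 0] with n hn
  have : (n : ℝ) ≠ 0 := by positivity
  field_simp
  ring

/-- The factors `q ^ (n + s)` and `exp (±(n + s) * charExponent)` cancel; they are inserted so that
the first quotient tends to `1` and the last factor carries the Gaussian. At variance zero, division
by zero makes both sides `1`. -/
theorem charFun_map_normalized (hq : q ≠ 0) (A C t : ℝ) (n : ℕ) :
    charFun ((unif s b n).map fun m =>
      ((numSummands s b m : ℝ) - mean s b n) / √(var s b n)) t =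
    charSum s b (t / √(var s b n)) (n + s) *
      (q * Complex.exp (-charExponent A C (t / √(var s b n)))) ^ (n + s) /
        (normCount s b q (n + s) : ℂ) *
      Complex.exp ((n + s : ℕ) * charExponent A C (t / √(var s b n)) -
        (t / √(var s b n) : ℝ) * mean s b n * Complex.I) := by
  rw [charFun_apply_real, integral_map Measurable.of_discrete.aemeasurable (by fun_prop)]
  set θ : ℝ := t / √(var s b n) with hθ
  have h1 : ∀ m, Complex.exp (t * (((numSummands s b m : ℝ) - mean s b n) / √(var s b n) : ℝ) *
      Complex.I) = Complex.exp (θ * (numSummands s b m : ℕ) * Complex.I) *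
        Complex.exp (-(θ * mean s b n * Complex.I)) := by
    intro m
    rw [← Complex.exp_add, hθ]
    push_cast
    ring_nf
  simp only [h1]
  rw [integral_mul_const, integral_comp_numSummands fun y : ℕ => Complex.exp (θ * y * Complex.I)]
  have hq' : (q : ℂ) ≠ 0 := by exact_mod_cast hq
  have hc : ((binSum s b (fun _ => (1 : ℝ)) (n + s) : ℝ) : ℂ) ≠ 0 :=
    Complex.ofReal_ne_zero.2 (binSum_one_pos s b (n + s)).ne'
  rw [sub_eq_add_neg, Complex.exp_add, mul_pow, ← Complex.exp_nat_mul, normCount, mul_neg,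
    Complex.exp_neg ((n + s : ℕ) * charExponent A C θ), Complex.real_smul, ← charSum]
  have he := Complex.exp_ne_zero ((n + s : ℕ) * charExponent A C θ)
  push_cast at he ⊢
  field_simp

theorem tendsto_charFun_normalized (hb : 1 ≤ b) (h : IsGrowthData s b p q A C) (t : ℝ) :
    Tendsto (fun n => charFun ((unif s b n).map fun m =>
      ((numSummands s b m : ℝ) - mean s b n) / √(var s b n)) t) atTop
      (nhds (Complex.exp (-(t ^ 2 / 2)))) := by
  have hp := h.p_pos
  have hC := h.var_pos
  have hQ : (1 + s * p : ℝ) ≠ 0 := by positivity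
  have hvar := tendsto_var_div hb h
  have hvtop : Tendsto (var s b) atTop atTop := by
    refine (hvar.pos_mul_atTop hC tendsto_natCast_atTop_atTop).congr' ?_
    filter_upwards [eventually_gt_atTop 0] with n hn
    have : (n : ℝ) ≠ 0 := by positivity
    field_simp
  set θ : ℕ → ℝ := fun n => t / √(var s b n) with hθdef
  have hθ : Tendsto θ atTop (nhds 0) :=
    tendsto_const_nhds.div_atTop (Real.tendsto_sqrt_atTop.comp hvtop)
  have hτ : Tendsto (fun n : ℕ => n * θ n ^ 2) atTop (nhds (t ^ 2 / C)) := by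
    refine ((tendsto_const_nhds (x := t ^ 2)).div hvar hC.ne').congr fun n => ?_
    simp only [hθdef]
    have hv : 0 ≤ var s b n := variance_nonneg _ _
    rw [div_pow, Real.sq_sqrt hv, Pi.div_apply, div_div_eq_mul_div]
    ring
  have hsum := tendsto_charSum hb h hθ hτ
  have hcount : Tendsto (fun n => (normCount s b q (n + s) : ℂ)) atTop
      (nhds ((1 + s * p)⁻¹ : ℝ)) :=
    (Complex.continuous_ofReal.tendsto _).comp
      ((tendsto_normCount hb h).comp (tendsto_add_atTop_nat s))
  -- The exponent is `-iθ (mean - A (n + s)) - C (n + s) θ² / 2`. The first term vanishes since the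
  -- bracket converges, and the second tends to `-t² / 2` since `n θ²` tends to `t² / C`.
  have hexp : Tendsto (fun n : ℕ => (n + s : ℕ) * charExponent A C (θ n) -
      (θ n : ℝ) * mean s b n * Complex.I) atTop (nhds (-(t ^ 2 / 2))) := by
    have h1 : Tendsto (fun n => θ n * (mean s b n - A * (n + s))) atTop (nhds 0) := by
      simpa using hθ.mul (tendsto_mean_sub hb h)
    have h2 : Tendsto (fun n : ℕ => C / 2 * (n * θ n ^ 2 + s * θ n ^ 2)) atTop
        (nhds (t ^ 2 / 2)) := by
      have := (hτ.add ((hθ.pow 2).const_mul (s : ℝ))).const_mul (C / 2)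
      convert this using 2
      field_simp
      ring
    have h3 := (((Complex.continuous_ofReal.tendsto _).comp h1).mul_const Complex.I).add
      ((Complex.continuous_ofReal.tendsto _).comp h2)
    have h4 := h3.neg
    convert! h4 using 2 with n
    · simp only [charExponent, Function.comp]
      push_cast
      ring
    · push_cast
      ring
  have hlim := (hsum.div hcount (by exact_mod_cast inv_ne_zero hQ)).mul
    ((Complex.continuous_exp.tendsto _).comp hexp)
  have hone : (1 / (1 + s * p) : ℂ) / ((1 + s * p)⁻¹ : ℝ) = 1 := by
    have : (1 + s * p : ℂ) ≠ 0 := by exact_mod_cast hQ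
    push_cast
    field_simp
  rw [hone, one_mul] at hlim
  exact hlim.congr fun n => (charFun_map_normalized h.q_pos.ne' A C t n).symm

theorem tendstoInDistribution_normalized (hb : 1 ≤ b) :
    TendstoInDistribution
      (fun (n : ℕ) (m : ℕ) => ((numSummands s b m : ℝ) - mean s b n) / √(var s b n))
      atTop (id : ℝ → ℝ) (fun n => unif s b n) (gaussianReal 0 1) where
  forall_aemeasurable n := Measurable.of_discrete.aemeasurable
  tendsto := by
    obtain ⟨p, q, A, C, h⟩ := exists_isGrowthData s hb
    refine ProbabilityMeasure.tendsto_iff_tendsto_charFun.2 fun t => ?_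
    rw! [Measure.map_id]
    simpa [charFun_gaussianReal] using tendsto_charFun_normalized hb h t

end CharFun

end Generacci

theorem mainTheorem5 (s b : ℕ) (hs : 1 ≤ s) (hb : 1 ≤ b) :
    (∀ m : ℕ, ∃! S : Finset ℕ,
      Generacci.IsLegalDecomp s b (Generacci.generacci s b) m S) ∧
    (∃ A B C D : ℝ, 0 < A ∧ 0 < B ∧ 0 < C ∧ 0 < D ∧
      (fun n : ℕ => Generacci.mean s b n - (A * n + B)) =o[atTop] (fun _ => (1 : ℝ)) ∧
      (fun n : ℕ => Generacci.var s b n - (C * n + D)) =o[atTop] (fun _ => (1 : ℝ))) ∧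
    TendstoInDistribution
      (fun (n : ℕ) (m : ℕ) =>
        ((Generacci.numSummands s b m : ℝ) - Generacci.mean s b n) / √(Generacci.var s b n))
      atTop (id : ℝ → ℝ) (fun n => Generacci.unif s b n) (gaussianReal 0 1) := by
  obtain ⟨p, q, A, C, h⟩ := Generacci.exists_isGrowthData s hb
  exact ⟨Generacci.existsUnique_isLegalDecomp hb, Generacci.exists_mean_var_asymptotics hs hb h,
    Generacci.tendstoInDistribution_normalized hb⟩
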